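/- \textbf{Setting.} Assume $\diamondsuit$. Fix an enumeration $\{C_\alpha\}_{\alpha<\omega_1}$ of all countable subsets of $\omega_1$ with $C_\alpha\subseteq\alpha$ for all $\alpha$, and a sequence $\{B_\beta\}_{\beta<\omega_1}$ such that for every uncountable $B\subseteq[\omega_1]^{<\omega}$ the set $\{\beta<\omega_1 : B\cap[\beta]^{<\omega}=B_\beta\}$ is stationary. For $Q\subseteq\mathbb{R}$ let $Q^*=\{H\in[\mathbb{R}]^{<\omega}:H\subseteq Q\}$, and let $\mathcal{W}$ be the countable family of all $Q^*$ with $Q$ a disjoint union of finitely many open intervals with rational endpoints. For a cardinal $\vartheta$ let $H(\vartheta)$ be the collection of sets whose transitive closure has cardinality less than $\vartheta$. Fix a cardinal $\kappa$ (arbitrary); "$\vartheta$ sufficiently large" means that $\vartheta>\kappa$ is regular. Let $U^\alpha_\gamma$ ($\gamma\le\alpha<\omega_1$) be sets and $\varphi_\alpha:\alpha+1\to[\mathbb{R}]^{<\omega}$ ($\alpha<\omega_1$) functions. Let $\tau_\alpha$ be the topology on $\alpha+1$ generated by the subbase $\{U^\alpha_\gamma:\gamma\le\alpha\}\cup\{\varphi_\alpha^{-1}(W):W\in\mathcal{W}\}$,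 and for finite $F\subseteq\alpha+1$ let $U^\alpha_F=\{\xi\le\alpha : \xi\in U^\alpha_\gamma\text{ for all }\gamma\in F\}$. Let $T_\alpha$ be the set of all $\beta\le\alpha$ such that $B_\beta$ is a pairwise disjoint family of finite subsets of $\beta$ and, for some sufficiently large $\vartheta$, there is a countable elementary submodel $M\prec H(\vartheta)$ such that (i) $M\cap\omega_1=\beta$; (ii) $\mathcal{W},\{B_\gamma\}_{\gamma<\omega_1}\in M$; (iii) there is a function $\varphi\in M$ with $\varphi\restriction\beta=\varphi_\beta\restriction\beta$; (iv) there is an uncountable $B\in M$ with $M\cap B=B_\beta$; (v) there is $\{V_\gamma\}_{\gamma<\omega_1}\in M$ with $V_\gamma\cap\beta=U^\beta_\gamma\cap\beta$ for all $\gamma<\beta$. Suppose that the following hold. \begin{enumerate} \item $U^\alpha_\gamma\subseteq\alpha+1$ and $U^\alpha_\alpha=\alpha+1$ for $\gamma\le\alpha<\omega_1$, and for each $\alpha$ the sets $\varphi_\alpha(\gamma)$, $\gamma\le\alpha$, are pairwise disjoint. \item $U^\alpha_\gamma=U^{\alpha_0}_\gamma\cap(\alpha+1)$ and $\varphi_\alpha=\varphi_{\alpha_0}\restriction(\alpha+1)$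 for all $\gamma\le\alpha\le\alpha_0<\omega_1$. \item If $C_\alpha$ is closed and discrete in $\tau_\alpha$, then $\bigcup\{U^\alpha_\gamma:\gamma\in C_\alpha\}\ne\alpha+1$. \item If $\beta\in T_\alpha$, then every $\tau_\alpha$-open set containing $\beta$ includes a member of $B_\beta$; and if $\beta\in T_\alpha\cap\alpha$, then for every $V\in\tau_\alpha$ with $\beta\in V$, every finite subset of $(\beta,\alpha]$ is contained in some $U^\alpha_F$ with $F\in B_\beta$ and $F\subseteq V$. \end{enumerate} Let $U_\gamma=\bigcup\{U^\alpha_\gamma:\gamma\le\alpha<\omega_1\}$ and $\varphi=\bigcup\{\varphi_\alpha:\alpha<\omega_1\}$, and let $X$ be the set $\omega_1$ with the topology generated by the subbase $\{U_\gamma:\gamma<\omega_1\}\cup\{\varphi^{-1}(W):W\in\mathcal{W}\}$. \textbf{Theorem.} Every subspace $Y$ of $X$ is an $(\varepsilon)$-space: if $\mathcal{U}$ is a family of open subsets of $Y$ such that every finite subset of $Y$ is contained in a member of $\mathcal{U}$ (an open $\omega$-cover), then some countable $\mathcal{V}\subseteq\mathcal{U}$ has the same property. Moreover, every finite power $X^n$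 is Lindel\"of, i.e. every open cover of $X^n$ has a countable subcover. -/

import Mathlib

open Set Topology

/-! ### Covering notions -/

/-- `𝒰` is an `ω`-cover of `A`: every finite subset of `A` is contained in one member of `𝒰`. -/
def IsOmegaCoverOf {X : Type*} (𝒰 : Set (Set X)) (A : Set X) : Prop :=
  ∀ K : Finset X, (K : Set X) ⊆ A → ∃ V ∈ 𝒰, (K : Set X) ⊆ V

/-- An `(ε)`-space: every open `ω`-cover has a countable `ω`-subcover. -/
def IsEpsilonSpace (X : Type*) [TopologicalSpace X] : Prop :=
  ∀ 𝒰 : Set (Set X), (∀ V ∈ 𝒰, IsOpen V) → IsOmegaCoverOf 𝒰 univ →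
    ∃ 𝒱 ⊆ 𝒰, 𝒱.Countable ∧ IsOmegaCoverOf 𝒱 univ

/-- `𝒩` is a local `π`-network at `x`: every open neighbourhood of `x` contains a member of `𝒩`. -/
def IsLocalPiNetwork {X : Type*} [TopologicalSpace X] (𝒩 : Set (Set X)) (x : X) : Prop :=
  ∀ V : Set X, IsOpen V → x ∈ V → ∃ N ∈ 𝒩, N ⊆ V

/-! ### The models `H(θ)` and their elementary submodels -/

/-- The only symbol of the language of set theory is the binary relation symbol `∈`. -/
inductive MemRel : ℕ → Type
  | mem : MemRel 2

/-- The first-order language of set theory. -/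
def setLang : FirstOrder.Language.{0, 0} := ⟨fun _ => Empty, MemRel⟩

/-- `H(θ)`: the sets whose transitive closure has fewer than `θ` elements. -/
def HSet (θ : Cardinal.{0}) : Set ZFSet.{0} :=
  {x | Cardinal.mk {y : ZFSet.{0} // Relation.TransGen (· ∈ ·) y x} < Cardinal.lift.{1} θ}

/-- `H(θ)` as a structure for the language of set theory, with the true membership relation. -/
instance instStructureHSet (θ : Cardinal.{0}) : setLang.Structure (HSet θ) where
  funMap := fun f _ => nomatch f
  RelMap := fun r v => match r, v with
    | MemRel.mem, v => (v 0 : ZFSet.{0}) ∈ (v 1 : ZFSet.{0})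

/-- `M` is a countable elementary submodel of `H(θ)`. -/
def IsCountableElementary (M : Set ZFSet.{0}) (θ : Cardinal.{0}) : Prop :=
  M.Countable ∧ ∃ S : setLang.ElementarySubstructure (HSet θ), M = Subtype.val '' (S : Set (HSet θ))

/-! ### The objects of the construction as sets of ZFC -/

/-- The set of countable ordinals, with its well-order. It carries no topology. -/
abbrev Omega1 : Type := (Ordinal.omega.{0} 1).ToType

/-- The set `{c a : a ∈ s}`, for a coding `c` of the elements of `A` by sets. -/
noncomputable def codeSet {A : Type} (c : A → ZFSet.{0}) (s : Set A) : ZFSet.{0} :=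
  ZFSet.range fun a : s => c a

/-- The function `f` as a set of Kuratowski pairs, for codings `c`, `d` of its arguments
and of its values. -/
noncomputable def codeFun {A B : Type} (c : A → ZFSet.{0}) (d : B → ZFSet.{0}) (f : A → B) :
    ZFSet.{0} :=
  ZFSet.range fun a : A => ZFSet.pair (c a) (d (f a))

/-- A countable ordinal as a von Neumann ordinal. -/
noncomputable def codeOrd (α : Omega1) : ZFSet.{0} :=
  ((Ordinal.ToType.toOrd α : Set.Iio (Ordinal.omega.{0} 1)) : Ordinal.{0}).toZFSet

/-- A finite set of countable ordinals as a set. -/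
noncomputable def codeFin (F : Finset Omega1) : ZFSet.{0} := codeSet codeOrd (F : Set Omega1)

/-- A rational number as a finite von Neumann ordinal, through a fixed enumeration. -/
noncomputable def codeRat (q : ℚ) : ZFSet.{0} := ((Encodable.encode q : ℕ) : Ordinal.{0}).toZFSet

/-- A real number as a Dedekind cut. -/
noncomputable def codeReal (x : ℝ) : ZFSet.{0} := codeSet codeRat {q : ℚ | (q : ℝ) < x}

/-- A finite set of reals as a set. -/
noncomputable def codeFinReal (H : Finset ℝ) : ZFSet.{0} := codeSet codeReal (H : Set ℝ)

/-- The countable base `𝒲` of the topology `ρ` on the finite sets of reals. Its members are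
the sets `Q* = {H : H ⊆ Q}`, where `Q` is a disjoint union of finitely many open intervals with
rational endpoints. -/
def rhoBase : Set (Set (Finset ℝ)) :=
  {W | ∃ I : Finset (ℚ × ℚ),
    (I : Set (ℚ × ℚ)).PairwiseDisjoint (fun p => Ioo (p.1 : ℝ) (p.2 : ℝ)) ∧
    W = {H : Finset ℝ | (H : Set ℝ) ⊆ ⋃ p ∈ I, Ioo (p.1 : ℝ) (p.2 : ℝ)}}

/-- The set `𝒲` as a set of ZFC. -/
noncomputable def codeRhoBase : ZFSet.{0} := codeSet (codeSet codeFinReal) rhoBase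

/-- A sequence `(B_γ)_{γ < ω₁}` of families of finite subsets of `ω₁` as a set of ZFC. -/
noncomputable def codeSeq (B : Omega1 → Set (Finset Omega1)) : ZFSet.{0} :=
  codeFun codeOrd (codeSet codeFin) B

/-! ### The data fixed before the construction -/

/-- `(C_α)_{α < ω₁}` enumerates the countable subsets of `ω₁`, with `C_α ⊆ α`. -/
def IsCountableSetEnumeration (C : Omega1 → Set Omega1) : Prop :=
  Set.range C = {s : Set Omega1 | s.Countable} ∧ ∀ α, C α ⊆ Iio α

/-- `(B_β)_{β < ω₁}` is a `◇`-sequence on the finite subsets of `ω₁`: for every uncountable family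
`A` of finite subsets, `A ∩ [β]^{<ω} = B_β` for stationarily many `β`. -/
def IsDiamondSequence (B : Omega1 → Set (Finset Omega1)) : Prop :=
  ∀ A : Set (Finset Omega1), ¬ A.Countable →
    IsStationary {β : Omega1 | {F ∈ A | (F : Set Omega1) ⊆ Iio β} = B β}

/-! ### The construction

`U α γ` and `φ α γ` stand for `U^α_γ` and `φ_α(γ)`. Only their values for `γ ≤ α` are used. -/

/-- The topology `τ_α` on `α + 1`, by its subbase. -/
abbrev stageTopology (U : Omega1 → Omega1 → Set Omega1) (φ : Omega1 → Omega1 → Finset ℝ)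
    (α : Omega1) : TopologicalSpace (Iic α) :=
  TopologicalSpace.generateFrom
    ({s | ∃ γ ≤ α, s = {x : Iic α | (x : Omega1) ∈ U α γ}} ∪
      {s | ∃ W ∈ rhoBase, s = {x : Iic α | φ α x ∈ W}})

/-- `U^α_F`, the intersection of the sets `U^α_γ` for `γ ∈ F`, in `α + 1`. -/
def stageInter (U : Omega1 → Omega1 → Set Omega1) (α : Omega1) (F : Finset Omega1) : Set Omega1 :=
  {ξ | ξ ≤ α ∧ ∀ γ ∈ F, ξ ∈ U α γ}

/-- `M` is a countable elementary submodel of `H(θ)` that satisfies conditions (i)-(v) for `β`. -/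
structure IsWitness (B : Omega1 → Set (Finset Omega1)) (U : Omega1 → Omega1 → Set Omega1)
    (φ : Omega1 → Omega1 → Finset ℝ) (θ : Cardinal.{0}) (β : Omega1) (M : Set ZFSet.{0}) :
    Prop where
  elementary : IsCountableElementary M θ
  /-- `M ∩ ω₁ = β` -/
  inter_omega1 : {γ : Omega1 | codeOrd γ ∈ M} = Iio β
  /-- `𝒲` and `(B_γ)_{γ < ω₁}` belong to `M` -/
  base_mem : codeRhoBase ∈ M
  seq_mem : codeSeq B ∈ M
  /-- some function in `M` agrees with `φ_β` on `β` -/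
  exists_phi : ∃ f ∈ M, (∃ a b, ZFSet.IsFunc a b f) ∧
    ∀ γ < β, ZFSet.pair (codeOrd γ) (codeFinReal (φ β γ)) ∈ f
  /-- some uncountable set `A ∈ M` has `M ∩ A = B_β` -/
  exists_family : ∃ A ∈ M, ¬ (A : Set ZFSet.{0}).Countable ∧
    M ∩ (A : Set ZFSet.{0}) = codeFin '' B β
  /-- some sequence `(V_γ)_{γ < ω₁} ∈ M` has `V_γ ∩ β = U^β_γ ∩ β` for all `γ < β` -/
  exists_nbhds : ∃ v ∈ M, (∃ b, ZFSet.IsFunc (codeSet codeOrd univ) b v) ∧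
    ∀ γ < β, ∃ V, ZFSet.pair (codeOrd γ) V ∈ v ∧
      V ∩ codeSet codeOrd (Iio β) = codeSet codeOrd (U β γ ∩ Iio β)

/-- The set `T_α`. "Sufficiently large `θ`" means a regular cardinal `θ > κ`. -/
def stageT (κ : Cardinal.{0}) (B : Omega1 → Set (Finset Omega1))
    (U : Omega1 → Omega1 → Set Omega1) (φ : Omega1 → Omega1 → Finset ℝ) (α : Omega1) :
    Set Omega1 :=
  {β | β ≤ α ∧ (B β).PairwiseDisjoint id ∧ (∀ F ∈ B β, (F : Set Omega1) ⊆ Iio β) ∧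
    ∃ θ : Cardinal.{0}, κ < θ ∧ θ.IsRegular ∧ ∃ M, IsWitness B U φ θ β M}

/-- `(U^α_γ)_{γ ≤ α < ω₁}` and `(φ_α)_{α < ω₁}` satisfy the requirements of the construction. -/
structure IsConstruction (κ : Cardinal.{0}) (C : Omega1 → Set Omega1)
    (B : Omega1 → Set (Finset Omega1)) (U : Omega1 → Omega1 → Set Omega1)
    (φ : Omega1 → Omega1 → Finset ℝ) : Prop where
  subset : ∀ α, ∀ γ ≤ α, U α γ ⊆ Iic α
  diagonal : ∀ α, U α α = Iic α
  disjoint : ∀ α, (Iic α).PairwiseDisjoint (φ α)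
  coherent_U : ∀ α₀, ∀ α ≤ α₀, ∀ γ ≤ α, U α γ = U α₀ γ ∩ Iic α
  coherent_phi : ∀ α₀, ∀ α ≤ α₀, ∀ γ ≤ α, φ α γ = φ α₀ γ
  /-- If `C_α` is closed discrete in `τ_α`, then the `U^α_γ` with `γ ∈ C_α` do not cover `α + 1`. -/
  not_cover : ∀ α, IsClosed[stageTopology U φ α] {x : Iic α | (x : Omega1) ∈ C α} →
    @IsDiscrete _ (stageTopology U φ α) {x : Iic α | (x : Omega1) ∈ C α} →
    ⋃ γ ∈ C α, U α γ ≠ Iic α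
  /-- If `β ∈ T_α`, then `B_β` is a local `π`-network at `β` in `τ_α`. -/
  piNetwork : ∀ α β, ∀ h : β ∈ stageT κ B U φ α,
    @IsLocalPiNetwork _ (stageTopology U φ α)
      {N | ∃ F ∈ B β, N = {x : Iic α | (x : Omega1) ∈ F}} ⟨β, h.1⟩
  /-- If `β ∈ T_α ∩ α` and `V` is a `τ_α`-open set containing `β`, then the sets `U^α_F` with
  `F ∈ B_β`, `F ⊆ V` form an `ω`-cover of `(β, α]`. -/
  omegaCover : ∀ α β, ∀ h : β ∈ stageT κ B U φ α, β < α →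
    ∀ V : Set (Iic α), IsOpen[stageTopology U φ α] V → (⟨β, h.1⟩ : Iic α) ∈ V →
      IsOmegaCoverOf {s | ∃ F ∈ B β, {x : Iic α | (x : Omega1) ∈ F} ⊆ V ∧ s = stageInter U α F}
        (Ioc β α)

/-! ### The resulting space -/

/-- `U_γ`, the union of the sets `U^α_γ` over `α ≥ γ`. -/
def limitU (U : Omega1 → Omega1 → Set Omega1) (γ : Omega1) : Set Omega1 :=
  ⋃ α ∈ Ici γ, U α γ

/-- The union `φ` of the coherent functions `φ_α`. -/
def limitPhi (φ : Omega1 → Omega1 → Finset ℝ) (γ : Omega1) : Finset ℝ := φ γ γ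

/-- The underlying set `ω₁` of the space `X`. -/
def SpaceX (_U : Omega1 → Omega1 → Set Omega1) (_φ : Omega1 → Omega1 → Finset ℝ) : Type := Omega1

/-- The topology `τ` of `X`, by its subbase. -/
instance instTopologicalSpaceSpaceX (U : Omega1 → Omega1 → Set Omega1)
    (φ : Omega1 → Omega1 → Finset ℝ) : TopologicalSpace (SpaceX U φ) :=
  TopologicalSpace.generateFrom
    ({s : Set Omega1 | ∃ γ, s = limitU U γ} ∪
      {s : Set Omega1 | ∃ W ∈ rhoBase, s = {x | limitPhi φ x ∈ W}})

/-! If an open ω-cover of Y had no countable ω-subcover, recursion on ω₁ would give finite sets K_α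
and members V_α ⊇ K_α of the cover with K_α ⊄ V_ξ for all ξ < α. Shrink V_α to a finite union of
basic sets containing K_α. `exists_lt_subset_basicUnion` refutes this by finding ξ < α such that K_α
lies in the union chosen for ξ.

To find ξ, thin out to uncountably many α whose data are pairwise disjoint outside a finite set R,
lie above R outside R, and have the same trace on R and the same members of 𝒲. Let D_α be the set of
indices γ of the sets U_γ used at α, without R. It then suffices that K_α ⊆ U_γ for all γ ∈ D_ξ.
Apply ◇ to the disjoint family of the D_α: by `exists_mem_stageT`, some B_β consists of the D_ξ
contained in β, where β lies in every T_α with α ≥ β. For large α the set K_α \ R lies above β, so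
the ω-cover requirement puts it inside U_F for some F = D_ξ. Points of R are below D_ξ and hence in
each U_γ, because U_γ contains γ + 1.

Finite powers are Lindelöf because open sets O whose power Oⁿ is covered by finitely many members of
a given cover form an ω-cover. -/

namespace Omega1

/-! ### Countable sets and clubs in ω₁. -/

theorem countable_Iio (a : Omega1) : (Iio a).Countable := by
  have h := Cardinal.mk_Iio_lt a (by simp)
  rw [Cardinal.mk_toType, Ordinal.card_omega, ← Cardinal.succ_aleph0, Order.lt_succ_iff] at h
  exact Cardinal.le_aleph0_iff_set_countable.1 h

theorem exists_strict_bound {s : Set Omega1} (hs : s.Countable) : ∃ b, ∀ a ∈ s, a < b := by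
  have h : ¬ IsCofinal s := fun h => by
    have h₁ := Order.cof_le h
    rw [Ordinal.cof_toType, Cardinal.cof_omega_one] at h₁
    exact absurd (h₁.trans (Cardinal.le_aleph0_iff_set_countable.2 hs))
      (not_le.2 Cardinal.aleph0_lt_aleph_one)
  simpa [IsCofinal] using h

theorem countable_Iic (a : Omega1) : (Iic a).Countable := by
  obtain ⟨b, hb⟩ := exists_strict_bound (countable_singleton a)
  exact (countable_Iio b).mono fun x hx => lt_of_le_of_lt hx (hb a rfl)

theorem exists_mem_gt {s : Set Omega1} (hs : ¬ s.Countable) (a : Omega1) : ∃ b ∈ s, a < b := by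
  by_contra! h
  exact hs ((countable_Iic a).mono h)

/-- The finite sets of countable ordinals below `β` are countably many. -/
theorem countable_finset_below (β : Omega1) :
    {F : Finset Omega1 | (F : Set Omega1) ⊆ Iio β}.Countable := by
  have h := Set.countable_ofPred_finite_subset (countable_Iio β)
  exact MapsTo.countable_of_injOn (f := fun F : Finset Omega1 => (F : Set Omega1))
    (fun F hF => by exact ⟨F.finite_toSet, hF⟩) Finset.coe_injective.injOn h

theorem exists_bound_of_isLUB {d : Set Omega1} (hd : d.Nonempty) {a : Omega1} (ha : IsLUB d a)
    (F : Finset Omega1) (hF : (F : Set Omega1) ⊆ Iio a) : ∃ b ∈ d, (F : Set Omega1) ⊆ Iio b := by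
  classical
  induction F using Finset.induction_on with
  | empty => obtain ⟨b, hb⟩ := hd; exact ⟨b, hb, by simp⟩
  | insert x F _ ih =>
    rw [Finset.coe_insert, insert_subset_iff] at hF
    obtain ⟨b, hb, hFb⟩ := ih hF.2
    obtain ⟨c, hc, hxc⟩ := (lt_isLUB_iff ha).1 hF.1
    refine ⟨max b c, ?_, ?_⟩
    · rcases max_choice b c with h | h <;> rwa [h]
    · rw [Finset.coe_insert, insert_subset_iff]
      exact ⟨lt_max_of_lt_right hxc, fun y hy => mem_Iio.2 (lt_max_of_lt_left (hFb hy))⟩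

/-- The ordinals closed under a countable-valued operation on finite sets form a club. -/
theorem isClub_closed (f : Finset Omega1 → Set Omega1) (hf : ∀ F, (f F).Countable) :
    IsClub {β : Omega1 | ∀ F : Finset Omega1, (F : Set Omega1) ⊆ Iio β → f F ⊆ Iio β} := by
  constructor
  · intro d hd hne _ a ha F hF
    obtain ⟨b, hb, hFb⟩ := exists_bound_of_isLUB hne ha F hF
    exact (hd hb F hFb).trans (Iio_subset_Iio (ha.1 hb))
  · intro a
    have hstep : ∀ b : Omega1, ∃ c, b < c ∧
        ∀ F : Finset Omega1, (F : Set Omega1) ⊆ Iio b → f F ⊆ Iio c := by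
      intro b
      obtain ⟨c, hc⟩ := exists_strict_bound
        (((countable_finset_below b).biUnion fun F _ => hf F).insert b)
      exact ⟨c, hc b (mem_insert _ _), fun F hF x hx =>
        hc x (mem_insert_of_mem _ (mem_biUnion hF hx))⟩
    choose g hg hgF using hstep
    -- The supremum of the iterates of `g` is closed under `f`: a finite set below it is already
    -- below some iterate, and its values are below the next one.
    have hne : (range fun n => g^[n] a).Nonempty := range_nonempty _
    obtain ⟨u, hu⟩ := exists_strict_bound (countable_range fun n => g^[n] a)
    obtain ⟨l, hl⟩ : ∃ l, IsLUB (range fun n => g^[n] a) l := by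
      have hex : ∃ l, l ∈ upperBounds (range fun n => g^[n] a) := ⟨u, fun x hx => (hu x hx).le⟩
      exact ⟨WellFounded.min wellFounded_lt _ hex, WellFounded.min_mem _ _ hex,
        fun y hy => WellFounded.min_le _ hy⟩
    refine ⟨l, fun F hF => ?_, hl.1 ⟨0, rfl⟩⟩
    obtain ⟨b, ⟨n, rfl⟩, hb⟩ := exists_bound_of_isLUB hne hl F hF
    refine (hgF _ F hb).trans (Iio_subset_Iio (hl.1 ⟨n + 1, ?_⟩))
    exact Function.iterate_succ_apply' g n a

end Omega1

/-! ### Faithfulness of the codings by sets. -/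

theorem codeOrd_injective : Function.Injective codeOrd := fun a b h => by
  have h₁ := Ordinal.toZFSet_injective h
  exact Ordinal.ToType.mk.symm.injective (Subtype.val_injective h₁)

theorem mem_codeSet {A : Type} {c : A → ZFSet.{0}} {s : Set A} {x : ZFSet.{0}} :
    x ∈ codeSet c s ↔ ∃ a ∈ s, c a = x := by
  simp [codeSet]

theorem codeSet_injective {A : Type} {c : A → ZFSet.{0}} (hc : Function.Injective c) :
    Function.Injective (codeSet c) := fun s t h => by
  ext a
  have h₁ : ∀ s : Set A, c a ∈ codeSet c s ↔ a ∈ s := fun s => by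
    simp [mem_codeSet, hc.eq_iff]
  rw [← h₁ s, h, h₁]

theorem codeSet_inter {A : Type} {c : A → ZFSet.{0}} (hc : Function.Injective c) (s t : Set A) :
    codeSet c s ∩ codeSet c t = codeSet c (s ∩ t) := by
  ext x
  simp only [ZFSet.mem_inter, mem_codeSet, mem_inter_iff]
  constructor
  · rintro ⟨⟨a, ha, rfl⟩, b, hb, hba⟩
    exact ⟨a, ⟨ha, hc hba ▸ hb⟩, rfl⟩
  · rintro ⟨a, ⟨ha, hb⟩, rfl⟩
    exact ⟨⟨a, ha, rfl⟩, a, hb, rfl⟩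

theorem codeFin_injective : Function.Injective codeFin :=
  (codeSet_injective codeOrd_injective).comp Finset.coe_injective

theorem pair_mem_codeFun {A B : Type} (c : A → ZFSet.{0}) (d : B → ZFSet.{0}) (f : A → B) (a : A) :
    ZFSet.pair (c a) (d (f a)) ∈ codeFun c d f := by
  simp only [codeFun, ZFSet.mem_range]
  exact ⟨a, rfl⟩

theorem isFunc_codeFun {A B : Type} {c : A → ZFSet.{0}} (hc : Function.Injective c)
    (d : B → ZFSet.{0}) (f : A → B) :
    ZFSet.IsFunc (codeSet c univ) (codeSet d univ) (codeFun c d f) := by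
  constructor
  · intro x hx
    simp only [codeFun, ZFSet.mem_range] at hx
    obtain ⟨a, rfl⟩ := hx
    simp [mem_codeSet]
  · intro z hz
    obtain ⟨a, -, rfl⟩ := mem_codeSet.1 hz
    refine ⟨d (f a), pair_mem_codeFun c d f a, fun w hw => ?_⟩
    simp only [codeFun, ZFSet.mem_range, ZFSet.pair_inj] at hw
    obtain ⟨b, hb, rfl⟩ := hw
    rw [hc hb]

/-! ### Elementary submodels of `H(θ)` -/

/-- Everything in the transitive closure of x has smaller rank, so it lies in a single stage of the
cumulative hierarchy. This lets its cardinality be measured in the universe of θ. -/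
instance small_transGen_mem (x : ZFSet.{0}) :
    Small.{0} {y : ZFSet.{0} // Relation.TransGen (· ∈ ·) y x} := by
  have h : {y : ZFSet.{0} | Relation.TransGen (· ∈ ·) y x} ⊆
      {y | y ∈ ZFSet.vonNeumann x.rank} := fun y hy => by
    have h₁ : ∀ z, Relation.TransGen (· ∈ ·) y z → y.rank < z.rank := fun z hz => by
      induction hz with
      | single h => exact ZFSet.rank_lt_of_mem h
      | tail _ h ih => exact ih.trans (ZFSet.rank_lt_of_mem h)
    exact ZFSet.mem_vonNeumann.2 (h₁ x hy)
  have : Small.{0} {y | y ∈ ZFSet.vonNeumann x.rank} :=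
    (ZFSet.vonNeumann x.rank).small_coe
  exact small_subset h

theorem exists_regular_HSet (κ : Cardinal.{0}) {ι : Type} (f : ι → ZFSet.{0}) :
    ∃ θ : Cardinal.{0}, κ < θ ∧ θ.IsRegular ∧ ∀ i, f i ∈ HSet θ := by
  let μ : ι → Cardinal.{0} := fun i =>
    Cardinal.mk (Shrink.{0} {y : ZFSet.{0} // Relation.TransGen (· ∈ ·) y (f i)})
  refine ⟨Order.succ (max (max κ Cardinal.aleph0) (⨆ i, μ i)), ?_, ?_, fun i => ?_⟩
  · exact Order.lt_succ_of_le ((le_max_left _ _).trans (le_max_left _ _))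
  · exact Cardinal.isRegular_succ ((le_max_right _ _).trans (le_max_left _ _))
  · have h₁ : μ i < Order.succ (max (max κ Cardinal.aleph0) (⨆ i, μ i)) :=
      Order.lt_succ_of_le ((le_ciSup Cardinal.bddAbove_of_small i).trans (le_max_right _ _))
    have h₂ : Cardinal.mk {y : ZFSet.{0} // Relation.TransGen (· ∈ ·) y (f i)} =
        Cardinal.lift.{1} (μ i) := by
      exact (Cardinal.lift_mk_shrink'' {y : ZFSet.{0} // Relation.TransGen (· ∈ ·) y (f i)}).symm
    change Cardinal.mk _ < _
    rw [h₂]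
    exact Cardinal.lift_lt.2 h₁

instance : Countable (Σ n, setLang.Functions n) :=
  inferInstanceAs (Countable (Σ _ : ℕ, Empty))

instance : Countable (Σ n, setLang.Relations n) := by
  have h : Function.Injective (fun r : (Σ n, MemRel n) => r.1) := by
    rintro ⟨_, ⟨⟩⟩ ⟨_, ⟨⟩⟩ _
    rfl
  exact h.countable

instance : Countable (Σ n, (setLang.sum setLang.skolem₁).Functions n) := by
  rw [← Cardinal.mk_le_aleph0_iff]
  refine FirstOrder.Language.card_functions_sum_skolem₁_le.trans (max_le le_rfl ?_)
  have : Countable setLang.Symbols := inferInstanceAs (Countable (_ ⊕ _))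
  exact Cardinal.mk_le_aleph0

/-- Club many `β` are the trace on `ω₁` of a countable elementary submodel of `H(θ)` that contains
prescribed countably many parameters and exactly those finite subsets of `ω₁` that lie below `β`. -/
theorem exists_club_elementary {θ : Cardinal.{0}} {P : Set ZFSet.{0}} (hPc : P.Countable)
    (hP : P ⊆ HSet θ) (hord : ∀ γ, codeOrd γ ∈ HSet θ) (hfin : ∀ F, codeFin F ∈ HSet θ) :
    ∃ D : Set Omega1, IsClub D ∧ ∀ β ∈ D, ∃ M : Set ZFSet.{0}, IsCountableElementary M θ ∧ P ⊆ M ∧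
      {γ : Omega1 | codeOrd γ ∈ M} = Iio β ∧
      ∀ F : Finset Omega1, codeFin F ∈ M ↔ (F : Set Omega1) ⊆ Iio β := by
  classical
  have : Nonempty (HSet θ) := ⟨⟨_, hfin ∅⟩⟩
  -- The generators are indexed by finite F so that the hull for β is a directed union of hulls that
  -- depend only on finite subsets of β.
  let h : Finset Omega1 → Set (HSet θ) := fun F =>
    Subtype.val ⁻¹' (P ∪ codeOrd '' (F : Set Omega1) ∪ codeFin '' {G : Finset Omega1 | G ⊆ F})
  have hh : ∀ F, (h F).Countable := fun F =>
    ((hPc.union (F.countable_toSet.image _)).union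
      ((F.powerset.countable_toSet.mono fun G hG => by simpa using hG).image _)).preimage
      Subtype.val_injective
  have hmono : ∀ F G, F ⊆ G → h F ⊆ h G := fun F G hFG =>
    preimage_mono (union_subset_union (union_subset_union le_rfl
      (image_mono (Finset.coe_subset.2 hFG))) (image_mono fun K hK => Finset.Subset.trans hK hFG))
  -- Skolem hulls: they are elementary, and countable over countable sets since the language is
  -- countable.
  let cl : Set (HSet θ) → (setLang.sum setLang.skolem₁).Substructure (HSet θ) := fun s =>
    FirstOrder.Language.Substructure.closure _ s
  have hcl : ∀ s : Set (HSet θ), s.Countable → (cl s : Set (HSet θ)).Countable := fun s hs =>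
    hs.substructure_closure _
  -- If β is closed under `f`, then no hull of a finite F ⊆ β contains an ordinal ≥ β or a finite
  -- set that is not a subset of β.
  let f : Finset Omega1 → Set Omega1 := fun F =>
    {γ | (⟨codeOrd γ, hord γ⟩ : HSet θ) ∈ cl (h F)} ∪
      ⋃ G ∈ {G : Finset Omega1 | (⟨codeFin G, hfin G⟩ : HSet θ) ∈ cl (h F)}, (G : Set Omega1)
  have hf : ∀ F, (f F).Countable := fun F => by
    refine Set.Countable.union ?_ (Set.Countable.biUnion ?_ fun G _ => G.countable_toSet)
    · exact (hcl _ (hh F)).preimage (f := fun γ => (⟨codeOrd γ, hord γ⟩ : HSet θ))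
        fun a b hab => codeOrd_injective (congrArg Subtype.val hab)
    · exact (hcl _ (hh F)).preimage (f := fun G => (⟨codeFin G, hfin G⟩ : HSet θ))
        fun a b hab => codeFin_injective (congrArg Subtype.val hab)
  refine ⟨_, Omega1.isClub_closed f hf, fun β hβ => ?_⟩
  let I := {F : Finset Omega1 // (F : Set Omega1) ⊆ Iio β}
  have : Countable I := (Omega1.countable_finset_below β).to_subtype
  have : Nonempty I := ⟨⟨∅, by simp⟩⟩
  let G : Set (HSet θ) := ⋃ F : I, h F.1
  have hG : G.Countable := countable_iUnion fun F => hh F.1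
  have hmem : ∀ x, x ∈ cl G ↔ ∃ F : I, x ∈ cl (h F.1) := fun x => by
    simp only [cl, G, FirstOrder.Language.Substructure.closure_iUnion]
    refine FirstOrder.Language.Substructure.mem_iSup_of_directed fun F₁ F₂ => ?_
    refine ⟨⟨F₁.1 ∪ F₂.1, by simpa using ⟨F₁.2, F₂.2⟩⟩, ?_, ?_⟩
    · exact FirstOrder.Language.Substructure.closure_mono (hmono _ _ Finset.subset_union_left)
    · exact FirstOrder.Language.Substructure.closure_mono (hmono _ _ Finset.subset_union_right)
  have hGM : ∀ x ∈ G, x ∈ cl G := fun x hx => FirstOrder.Language.Substructure.subset_closure hx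
  have hval : ∀ (x : ZFSet.{0}) (hx : x ∈ HSet θ),
      x ∈ Subtype.val '' (cl G : Set (HSet θ)) ↔ (⟨x, hx⟩ : HSet θ) ∈ cl G := fun x hx =>
    ⟨fun ⟨y, hy, hyx⟩ => by subst hyx; exact hy, fun hx' => ⟨_, hx', rfl⟩⟩
  refine ⟨Subtype.val '' (cl G : Set (HSet θ)), ⟨(hcl G hG).image _,
    (cl G).elementarySkolem₁Reduct, rfl⟩, fun x hx => ?_, ?_, fun F => ?_⟩
  · exact (hval x (hP hx)).2 (hGM _ (mem_iUnion.2 ⟨Classical.arbitrary I, .inl (.inl hx)⟩))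
  · ext γ
    rw [mem_ofPred_eq, hval _ (hord γ)]
    constructor
    · intro hγ
      obtain ⟨F, hF⟩ := (hmem _).1 hγ
      exact hβ F.1 F.2 (.inl hF)
    · intro hγ
      refine hGM _ (mem_iUnion.2 ⟨⟨{γ}, by simpa using hγ⟩, .inl (.inr ⟨γ, by simp, rfl⟩)⟩)
  · rw [hval _ (hfin F)]
    constructor
    · intro hF x hx
      obtain ⟨K, hK⟩ := (hmem _).1 hF
      exact hβ K.1 K.2 (.inr (mem_biUnion hK hx))
    · intro hF
      exact hGM _ (mem_iUnion.2 ⟨⟨F, hF⟩, .inr ⟨F, Finset.Subset.refl F, rfl⟩⟩)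

/-! ### Reflection of uncountable disjoint families by ◇. -/

variable {κ : Cardinal.{0}} {C : Omega1 → Set Omega1} {B : Omega1 → Set (Finset Omega1)}
  {U : Omega1 → Omega1 → Set Omega1} {φ : Omega1 → Omega1 → Finset ℝ}

namespace IsConstruction

theorem limitU_inter (hX : IsConstruction κ C B U φ) {γ β : Omega1} (h : γ ≤ β) :
    limitU U γ ∩ Iic β = U β γ := by
  ext x
  simp only [limitU, mem_inter_iff, mem_iUnion, mem_Ici, mem_Iic]
  constructor
  · rintro ⟨⟨α, hα, hx⟩, hxβ⟩
    rcases le_total α β with hαβ | hβα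
    · rw [hX.coherent_U β α hαβ γ hα] at hx
      exact hx.1
    · rw [hX.coherent_U α β hβα γ h]
      exact ⟨hx, hxβ⟩
  · exact fun hx => ⟨⟨β, h, hx⟩, hX.subset β γ h hx⟩

theorem Iic_subset_limitU (hX : IsConstruction κ C B U φ) (γ : Omega1) : Iic γ ⊆ limitU U γ := by
  rw [← hX.diagonal γ, ← hX.limitU_inter le_rfl]
  exact inter_subset_left

/-- An uncountable pairwise disjoint family of finite sets is reflected by the diamond sequence at
some `β` that belongs to all sets `T_α`, `α ≥ β`. -/
theorem exists_mem_stageT (hX : IsConstruction κ C B U φ) (hB : IsDiamondSequence B)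
    {A : Set (Finset Omega1)} (hA : ¬ A.Countable) (hd : A.PairwiseDisjoint id) :
    ∃ β, (∀ α, β ≤ α → β ∈ stageT κ B U φ α) ∧ B β = {F ∈ A | (F : Set Omega1) ⊆ Iio β} := by
  -- These are the parameters that conditions (ii)-(v) require in M, with the limit objects φ and
  -- U_γ serving in (iii) and (v).
  let p : Fin 5 → ZFSet.{0} := ![codeRhoBase, codeSeq B, codeFun codeOrd codeFinReal (limitPhi φ),
    codeSet codeFin A, codeFun codeOrd (codeSet codeOrd) (limitU U)]
  obtain ⟨θ, hκ, hθ, hmem⟩ := exists_regular_HSet κ (Sum.elim p (Sum.elim codeOrd codeFin))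
  obtain ⟨D, hD, hDM⟩ := exists_club_elementary (θ := θ) (countable_range p)
    (by rintro _ ⟨i, rfl⟩; exact hmem (.inl i)) (fun γ => hmem (.inr (.inl γ)))
    (fun F => hmem (.inr (.inr F)))
  obtain ⟨β, hβB, hβD⟩ := hB A hA hD
  have hβB : {F ∈ A | (F : Set Omega1) ⊆ Iio β} = B β := hβB
  obtain ⟨M, hM, hpM, hord, hfin⟩ := hDM β hβD
  have hp : ∀ i, p i ∈ M := fun i => hpM ⟨i, rfl⟩
  refine ⟨β, fun α hα => ⟨hα, ?_, ?_, θ, hκ, hθ, M, ?_⟩, hβB.symm⟩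
  · rw [← hβB]
    exact hd.subset fun F hF => hF.1
  · rw [← hβB]
    exact fun F hF => hF.2
  refine ⟨hM, hord, hp 0, hp 1, ⟨_, hp 2, ⟨_, _, isFunc_codeFun codeOrd_injective _ _⟩, ?_⟩,
    ⟨_, hp 3, ?_, ?_⟩, ⟨_, hp 4, ⟨_, isFunc_codeFun codeOrd_injective _ _⟩, ?_⟩⟩
  · intro γ hγ
    rw [← hX.coherent_phi β γ hγ.le γ le_rfl]
    exact pair_mem_codeFun codeOrd codeFinReal (limitPhi φ) γ
  · intro hc
    refine hA (MapsTo.countable_of_injOn (f := codeFin) (fun F hF => ?_)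
      codeFin_injective.injOn hc)
    exact mem_codeSet.2 ⟨F, hF, rfl⟩
  · rw [← hβB]
    ext x
    constructor
    · rintro ⟨hxM, hx⟩
      obtain ⟨F, hF, rfl⟩ := mem_codeSet.1 hx
      exact ⟨F, ⟨hF, (hfin F).1 hxM⟩, rfl⟩
    · rintro ⟨F, hF, rfl⟩
      exact ⟨(hfin F).2 hF.2, mem_codeSet.2 ⟨F, hF.1, rfl⟩⟩
  · intro γ hγ
    refine ⟨_, pair_mem_codeFun codeOrd (codeSet codeOrd) (limitU U) γ, ?_⟩
    rw [codeSet_inter codeOrd_injective, ← hX.limitU_inter hγ.le, inter_assoc,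
      inter_eq_right.2 Iio_subset_Iic_self]

end IsConstruction

/-! ### Uncountable families of finite sets -/

theorem exists_not_countable_fiber {ι β : Type*} {I : Set ι} (hI : ¬ I.Countable) (f : ι → β)
    {S : Set β} (hS : S.Countable) (hf : MapsTo f I S) : ∃ b, ¬ {i ∈ I | f i = b}.Countable := by
  by_contra! h
  refine hI ((hS.biUnion fun b _ => h b).mono fun i hi => ?_)
  exact mem_biUnion (hf hi) ⟨hi, rfl⟩

/-- By disjointness, choosing a point of S in each set is injective. -/
theorem countable_meeting {ι α : Type*} {J : Set ι} {D : ι → Finset α} (hJ : J.PairwiseDisjoint D)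
    {S : Set α} (hS : S.Countable) : {i ∈ J | ∃ x ∈ D i, x ∈ S}.Countable := by
  have h : ∀ i : {i ∈ J | ∃ x ∈ D i, x ∈ S}, ∃ x ∈ D i.1, x ∈ S := fun i => i.2.2
  choose g hg hgS using h
  have : Countable S := hS.to_subtype
  have hinj : Function.Injective fun i => (⟨g i, hgS i⟩ : S) := fun i j hij => by
    by_contra hne
    have hd : Disjoint (D i.1) (D j.1) := hJ i.2.1 j.2.1 fun h => hne (Subtype.ext h)
    have hij : g i = g j := congrArg Subtype.val hij
    exact Finset.disjoint_left.1 hd (hg i) (hij ▸ hg j)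
  exact hinj.countable

/-- Induction on the size outside R. If uncountably many sets share a point outside R, move it into
R. Otherwise a maximal disjoint subfamily is uncountable, since a countable one would meet only
countably many of the sets. -/
theorem exists_pairwiseDisjoint_sdiff_of_card {ι α : Type*} [DecidableEq α] (E : ι → Finset α)
    (n : ℕ) : ∀ (I : Set ι) (R : Finset α), ¬ I.Countable → (∀ i ∈ I, (E i \ R).card = n) →
      ∃ J ⊆ I, ¬ J.Countable ∧ ∃ S, J.PairwiseDisjoint fun i => E i \ S := by
  induction n with
  | zero =>
    intro I R hI hc
    refine ⟨I, le_rfl, hI, R, fun i hi j _ _ => ?_⟩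
    have := Finset.card_eq_zero.1 (hc i hi)
    simp [Function.onFun, this]
  | succ n ih =>
    intro I R hI hc
    by_cases hx : ∃ x, ¬ {i ∈ I | x ∈ E i \ R}.Countable
    · obtain ⟨x, hx⟩ := hx
      obtain ⟨J, hJ, h⟩ := ih _ (insert x R) hx fun i hi => by
        have h₁ : E i \ insert x R = (E i \ R).erase x := by
          ext y; simp only [Finset.mem_sdiff, Finset.mem_insert, Finset.mem_erase]; tauto
        rw [h₁, Finset.card_erase_of_mem hi.2, hc i hi.1, Nat.add_sub_cancel]
      exact ⟨J, hJ.trans fun i hi => hi.1, h⟩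
    · push Not at hx
      obtain ⟨J, hJ⟩ := zorn_subset {J | J ⊆ I ∧ J.PairwiseDisjoint fun i => E i \ R}
        fun c hc hch => ⟨⋃₀ c, ⟨sUnion_subset fun s hs => (hc hs).1,
          (pairwiseDisjoint_sUnion hch.directedOn).2 fun s hs => (hc hs).2⟩,
          fun s hs => subset_sUnion_of_mem hs⟩
      refine ⟨J, hJ.prop.1, fun hJc => hI ?_, R, hJ.prop.2⟩
      refine (hJc.union (hJc.biUnion fun j _ => (E j \ R).countable_toSet.biUnion
        fun x _ => hx x)).mono fun i hi => ?_
      by_contra hn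
      simp only [mem_union, mem_iUnion, not_or, not_exists] at hn
      refine hn.1 (hJ.le_of_ge (y := insert i J) ⟨insert_subset hi hJ.prop.1, ?_⟩
        (subset_insert _ _) (mem_insert _ _))
      refine hJ.prop.2.insert fun j hj _ => Finset.disjoint_left.2 fun x hxi hxj => ?_
      exact hn.2 j hj x hxj ⟨hi, hxi⟩

/-- Every uncountable family of finite sets has an uncountable subfamily that is pairwise disjoint
outside a finite set. -/
theorem exists_pairwiseDisjoint_sdiff {ι α : Type*} [DecidableEq α] (E : ι → Finset α)
    {I : Set ι} (hI : ¬ I.Countable) :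
    ∃ J ⊆ I, ¬ J.Countable ∧ ∃ S, J.PairwiseDisjoint fun i => E i \ S := by
  obtain ⟨n, hn⟩ := exists_not_countable_fiber hI (fun i => (E i).card) (S := univ)
    countable_univ (mapsTo_univ _ _)
  obtain ⟨J, hJ, h⟩ := exists_pairwiseDisjoint_sdiff_of_card E n _ ∅ hn fun i hi => by
    simpa using hi.2
  exact ⟨J, hJ.trans fun i hi => hi.1, h⟩

theorem countable_rhoBase : rhoBase.Countable := by
  refine (countable_range fun I : Finset (ℚ × ℚ) =>
    {H : Finset ℝ | (H : Set ℝ) ⊆ ⋃ p ∈ I, Ioo (p.1 : ℝ) (p.2 : ℝ)}).mono ?_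
  rintro W ⟨I, -, rfl⟩
  exact ⟨I, rfl⟩

instance : Countable rhoBase := countable_rhoBase.to_subtype

/-! ### Finite unions of basic open sets -/

/-- The union of the basic open sets of `X` given by the members of `T`. -/
def basicUnion (U : Omega1 → Omega1 → Set Omega1) (φ : Omega1 → Omega1 → Finset ℝ)
    (T : Finset (Finset Omega1 × Finset rhoBase)) : Set Omega1 :=
  {x | ∃ p ∈ T, (∀ γ ∈ p.1, x ∈ limitU U γ) ∧ ∀ W ∈ p.2, limitPhi φ x ∈ (W : Set (Finset ℝ))}

theorem exists_basic_subset {G : Set Omega1} (hG : IsOpen (X := SpaceX U φ) G) {x : Omega1}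
    (hx : x ∈ G) : ∃ p : Finset Omega1 × Finset rhoBase,
      x ∈ basicUnion U φ {p} ∧ basicUnion U φ {p} ⊆ G := by
  classical
  have hG' : TopologicalSpace.GenerateOpen ({s : Set Omega1 | ∃ γ, s = limitU U γ} ∪
      {s : Set Omega1 | ∃ W ∈ rhoBase, s = {x | limitPhi φ x ∈ W}}) G := hG
  clear hG
  induction hG' with
  | basic s hs =>
    rcases hs with ⟨γ, rfl⟩ | ⟨W, hW, rfl⟩
    · exact ⟨({γ}, ∅), by simpa [basicUnion] using hx, fun y hy => by
        simpa [basicUnion] using hy⟩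
    · have h : basicUnion U φ {(∅, {⟨W, hW⟩})} = {x | limitPhi φ x ∈ W} := by
        ext y
        simp only [basicUnion, Finset.mem_singleton, exists_eq_left, forall_eq, mem_ofPred_eq,
          Finset.notMem_empty, false_imp_iff, implies_true, true_and]
      exact ⟨_, by rwa [h], h.le⟩
  | univ => exact ⟨(∅, ∅), by simp [basicUnion], subset_univ _⟩
  | inter s t _ _ ihs iht =>
    obtain ⟨p, hxp, hp⟩ := ihs hx.1
    obtain ⟨q, hxq, hq⟩ := iht hx.2
    have h : basicUnion U φ {(p.1 ∪ q.1, p.2 ∪ q.2)} =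
        basicUnion U φ {p} ∩ basicUnion U φ {q} := by
      ext y
      simp only [basicUnion, Finset.mem_singleton, exists_eq_left, Finset.mem_union, or_imp,
        forall_and, mem_ofPred_eq, mem_inter_iff]
      tauto
    exact ⟨_, by rw [h]; exact ⟨hxp, hxq⟩, by rw [h]; exact inter_subset_inter hp hq⟩
  | sUnion S _ ih =>
    obtain ⟨s, hs, hxs⟩ := hx
    obtain ⟨p, hxp, hp⟩ := ih s hs hxs
    exact ⟨p, hxp, hp.trans (subset_sUnion_of_mem hs)⟩

theorem exists_basicUnion_subset {G : Set Omega1} (hG : IsOpen (X := SpaceX U φ) G)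
    (K : Finset Omega1) (hK : (K : Set Omega1) ⊆ G) :
    ∃ T, (K : Set Omega1) ⊆ basicUnion U φ T ∧ basicUnion U φ T ⊆ G := by
  classical
  choose p hxp hp using fun x : K => exists_basic_subset hG (hK x.2)
  have h : ∀ y, y ∈ basicUnion U φ (Finset.univ.image p) ↔ ∃ x, y ∈ basicUnion U φ {p x} := by
    simp only [basicUnion, Finset.mem_image, Finset.mem_univ, true_and, Finset.mem_singleton,
      exists_eq_left, mem_ofPred_eq, exists_exists_eq_and, implies_true]
  exact ⟨Finset.univ.image p, fun x hx => (h x).2 ⟨⟨x, hx⟩, hxp ⟨x, hx⟩⟩,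
    fun y hy => by obtain ⟨x, hx⟩ := (h y).1 hy; exact hp x hx⟩

/-! ### The combinatorial core and countable ω-subcovers. -/

namespace IsConstruction

theorem exists_lt_subset_basicUnion (hX : IsConstruction κ C B U φ) (hB : IsDiamondSequence B)
    (K : Omega1 → Finset Omega1) (T : Omega1 → Finset (Finset Omega1 × Finset rhoBase))
    (hK : ∀ α, (K α : Set Omega1) ⊆ basicUnion U φ (T α)) :
    ∃ ξ α, ξ < α ∧ (K α : Set Omega1) ⊆ basicUnion U φ (T ξ) := by
  classical
  have huniv : ¬ (univ : Set Omega1).Countable := fun h => by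
    obtain ⟨b, hb⟩ := Omega1.exists_strict_bound h
    exact lt_irrefl b (hb b (mem_univ b))
  let E : Omega1 → Finset Omega1 := fun α => K α ∪ (T α).biUnion Prod.fst
  obtain ⟨J₁, -, hJ₁, R, hR⟩ := exists_pairwiseDisjoint_sdiff E huniv
  -- The pattern of the trace on R together with the members of 𝒲 takes only countably many values.
  obtain ⟨T₀, hT₀⟩ := exists_not_countable_fiber hJ₁
    (fun α => (T α).image fun p => (p.1.subtype (· ∈ R), p.2)) (S := univ)
    countable_univ (mapsTo_univ _ _)
  have hmeet : ∀ S : Set Omega1, S.Countable → {i ∈ J₁ | ∃ x ∈ E i \ R, x ∈ S}.Countable :=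
    fun S hS => countable_meeting hR hS
  -- Also discard the countably many indices whose data outside R are not entirely above R.
  let J : Set Omega1 := {i ∈ J₁ | (T i).image (fun p => (p.1.subtype (· ∈ R), p.2)) = T₀} \
    {i ∈ J₁ | ∃ x ∈ E i \ R, x ∈ ⋃ r ∈ R, Iic r}
  have hJ : ¬ J.Countable := fun h => hT₀ (((h.union (hmeet (⋃ r ∈ R, Iic r)
    (R.countable_toSet.biUnion fun r _ => Omega1.countable_Iic r)))).mono fun i hi => by
      by_cases hi' : i ∈ {i ∈ J₁ | ∃ x ∈ E i \ R, x ∈ ⋃ r ∈ R, Iic r}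
      · exact .inr hi'
      · exact .inl ⟨hi, hi'⟩)
  have hJJ : ∀ i ∈ J, i ∈ J₁ := fun i hi => hi.1.1
  let D : Omega1 → Finset Omega1 := fun α => (T α).biUnion Prod.fst \ R
  have hDE : ∀ α, D α ⊆ E α \ R := fun α =>
    Finset.sdiff_subset_sdiff Finset.subset_union_right le_rfl
  have hDdisj : J.PairwiseDisjoint D := fun i hi j hj hij =>
    (hR (hJJ i hi) (hJJ j hj) hij).mono (hDE i) (hDE j)
  have hgt : ∀ i ∈ J, ∀ x ∈ E i \ R, ∀ r ∈ R, r < x := fun i hi x hx r hr => by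
    by_contra h
    exact hi.2 ⟨hJJ i hi, x, hx, mem_biUnion hr (not_lt.1 h)⟩
  -- A basic set at α containing x has a counterpart at ξ with the same trace on R and the same
  -- members of 𝒲; only the indices in D ξ remain to be checked.
  have key : ∀ ξ ∈ J, ∀ α ∈ J, ∀ x ∈ K α, (∀ γ ∈ D ξ, x ∈ limitU U γ) →
      x ∈ basicUnion U φ (T ξ) := by
    intro ξ hξ α hα x hx hxD
    obtain ⟨p, hp, hp₁, hp₂⟩ := hK α hx
    have hq : (p.1.subtype (· ∈ R), p.2) ∈
        (T ξ).image fun p => (p.1.subtype (· ∈ R), p.2) := by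
      rw [hξ.1.2, ← hα.1.2]
      exact Finset.mem_image_of_mem _ hp
    obtain ⟨q, hq, hqp⟩ := Finset.mem_image.1 hq
    rw [Prod.mk.injEq] at hqp
    refine ⟨q, hq, fun γ hγ => ?_, hqp.2 ▸ hp₂⟩
    by_cases hγR : γ ∈ R
    · have h₁ : (⟨γ, hγR⟩ : {γ // γ ∈ R}) ∈ q.1.subtype (· ∈ R) := Finset.mem_subtype.2 hγ
      rw [hqp.1] at h₁
      exact hp₁ γ (Finset.mem_subtype.1 h₁)
    · exact hxD γ (Finset.mem_sdiff.2 ⟨Finset.mem_biUnion.2 ⟨q, hq, hγ⟩, hγR⟩)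
  by_cases hD : ∃ ξ ∈ J, D ξ = ∅
  · obtain ⟨ξ, hξ, hDξ⟩ := hD
    obtain ⟨α, hα, hξα⟩ := Omega1.exists_mem_gt hJ ξ
    exact ⟨ξ, α, hξα, fun x hx => key ξ hξ α hα x hx (by simp [hDξ])⟩
  push Not at hD
  have hinj : InjOn D J := fun i hi j hj hij => by
    by_contra hne
    have h := hDdisj hi hj hne
    rw [Function.onFun, ← hij, disjoint_self] at h
    exact (hD i hi).ne_empty h
  obtain ⟨β, hβ, hβB⟩ := hX.exists_mem_stageT hB (A := D '' J)
    (fun h => hJ (countable_of_injective_of_countable_image hinj h))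
    (by
      rintro _ ⟨i, hi, rfl⟩ _ ⟨j, hj, rfl⟩ hij
      exact hDdisj hi hj fun h => hij (congrArg D h))
  -- By disjointness, δ bounds the indices whose data outside R reach β or below. This puts `E α \
  -- R` above β when α > δ, and also gives ξ < δ when D ξ is a nonempty subset of β.
  obtain ⟨δ, hδ⟩ := Omega1.exists_strict_bound (hmeet (Iic β) (Omega1.countable_Iic β))
  obtain ⟨α, hα, hδα⟩ := Omega1.exists_mem_gt hJ δ
  have hαβ : ∀ x ∈ E α \ R, β < x := fun x hx => by
    by_contra h
    exact (hδ α ⟨hJJ α hα, x, hx, not_lt.1 h⟩).not_gt hδα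
  obtain ⟨α', hα'⟩ := Omega1.exists_strict_bound ((K α).countable_toSet.insert β)
  have hβα' : β < α' := hα' β (mem_insert _ _)
  -- Taking V to be the whole space leaves all of B β available.
  have hcov := hX.omegaCover α' β (hβ α' hβα'.le) hβα' univ
    (@isOpen_univ _ (stageTopology U φ α')) (mem_univ _)
  obtain ⟨_, ⟨F, hF, -, rfl⟩, hKF⟩ := hcov (K α \ R) fun x hx => by
    have hx := Finset.mem_sdiff.1 (Finset.mem_coe.1 hx)
    exact ⟨hαβ x (Finset.mem_sdiff.2 ⟨Finset.mem_union_left _ hx.1, hx.2⟩),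
      (hα' x (mem_insert_of_mem _ hx.1)).le⟩
  rw [hβB] at hF
  obtain ⟨⟨ξ, hξ, rfl⟩, hξβ⟩ := hF
  have hξδ : ξ < δ := by
    obtain ⟨x, hx⟩ := hD ξ hξ
    exact hδ ξ ⟨hJJ ξ hξ, x, hDE ξ hx, (show x < β from hξβ hx).le⟩
  refine ⟨ξ, α, hξδ.trans hδα, fun x hx => key ξ hξ α hα x hx fun γ hγ => ?_⟩
  by_cases hxR : x ∈ R
  · exact hX.Iic_subset_limitU γ (hgt ξ hξ γ (hDE ξ hγ) x hxR).le
  · have h₁ := (hKF (Finset.mem_coe.2 (Finset.mem_sdiff.2 ⟨hx, hxR⟩))).2 γ hγ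
    exact mem_biUnion (mem_Ici.2 ((show γ < β from hξβ hγ).trans hβα').le) h₁

/-- Every `ω`-cover of a subset of `X` by open subsets of `X` has a countable `ω`-subcover. -/
theorem exists_countable_omegaCover (hX : IsConstruction κ C B U φ) (hB : IsDiamondSequence B)
    (Y : Set (SpaceX U φ)) (𝒰 : Set (Set (SpaceX U φ))) (ho : ∀ V ∈ 𝒰, IsOpen V)
    (hc : IsOmegaCoverOf 𝒰 Y) : ∃ 𝒱 ⊆ 𝒰, 𝒱.Countable ∧ IsOmegaCoverOf 𝒱 Y := by
  classical
  by_contra! hn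
  -- The choice is a function of the set s of earlier members; the value for uncountable s is a
  -- dummy.
  have hstep : ∀ s : Set 𝒰, ∃ (K : Finset (SpaceX U φ)) (V : 𝒰), (K : Set (SpaceX U φ)) ⊆ V ∧
      (s.Countable → ∀ W ∈ s, ¬ (K : Set (SpaceX U φ)) ⊆ W) := fun s => by
    by_cases hs : s.Countable
    · have h := hn (Subtype.val '' s) (by rintro _ ⟨V, -, rfl⟩; exact V.2) (hs.image _)
      simp only [IsOmegaCoverOf, not_forall] at h
      obtain ⟨K, hKY, hK⟩ := h
      obtain ⟨V, hV, hKV⟩ := hc K hKY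
      exact ⟨K, ⟨V, hV⟩, hKV, fun _ W hW hKW => hK ⟨W, ⟨W, hW, rfl⟩, hKW⟩⟩
    · obtain ⟨V, hV, hKV⟩ := hc ∅ (by simp)
      exact ⟨∅, ⟨V, hV⟩, hKV, fun h => absurd h hs⟩
  choose K V hKV hK using hstep
  let v : Omega1 → 𝒰 := wellFounded_lt.fix fun α v => V (range fun ξ : Iio α => v ξ.1 ξ.2)
  have hv : ∀ α, v α = V (range fun ξ : Iio α => v ξ) := fun α =>
    WellFounded.fix_eq wellFounded_lt _ α
  choose T hKT hTV using fun α : Omega1 => exists_basicUnion_subset (ho _ (v α).2)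
    (K (range fun ξ : Iio α => v ξ)) (by rw [hv]; exact hKV _)
  obtain ⟨ξ, α, hξα, h⟩ := hX.exists_lt_subset_basicUnion hB _ T hKT
  have : Countable (Iio α) := (Omega1.countable_Iio α).to_subtype
  exact hK _ (countable_range _) (v ξ) ⟨⟨ξ, hξα⟩, rfl⟩ (h.trans (hTV ξ))

end IsConstruction

/-! ### Covering properties of subspaces and of finite powers -/

theorem isEpsilonSpace_subtype {X : Type*} [TopologicalSpace X] (Y : Set X)
    (h : ∀ 𝒰 : Set (Set X), (∀ V ∈ 𝒰, IsOpen V) → IsOmegaCoverOf 𝒰 Y →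
      ∃ 𝒱 ⊆ 𝒰, 𝒱.Countable ∧ IsOmegaCoverOf 𝒱 Y) : IsEpsilonSpace Y := by
  classical
  intro 𝒰 ho hc
  -- All open extensions of members of the cover are used, so no extension has to be chosen.
  obtain ⟨𝒱, h𝒱, h𝒱c, hcov⟩ := h {G | IsOpen G ∧ (Subtype.val ⁻¹' G : Set Y) ∈ 𝒰}
    (fun G hG => hG.1) fun K hK => by
      obtain ⟨V, hV, hKV⟩ := hc (K.subtype (· ∈ Y)) (subset_univ _)
      obtain ⟨G, hG, rfl⟩ := isOpen_induced_iff.1 (ho V hV)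
      exact ⟨G, ⟨hG, hV⟩, fun x hx => @hKV ⟨x, hK hx⟩ (Finset.mem_coe.2 (Finset.mem_subtype.2 hx))⟩
  refine ⟨(fun G => Subtype.val ⁻¹' G) '' 𝒱, ?_, h𝒱c.image _, fun K _ => ?_⟩
  · rintro _ ⟨G, hG, rfl⟩
    exact (h𝒱 hG).2
  · obtain ⟨G, hG, hKG⟩ := hcov (K.map (Function.Embedding.subtype _)) fun x hx => by
      obtain ⟨y, -, rfl⟩ := Finset.mem_map.1 (Finset.mem_coe.1 hx)
      exact y.2
    exact ⟨_, ⟨G, hG, rfl⟩, fun x hx => hKG (Finset.mem_coe.2 (Finset.mem_map_of_mem _ hx))⟩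

/-- The finite powers of an `(ε)`-space are Lindelöf. -/
theorem IsEpsilonSpace.lindelofSpace_pi {X : Type*} [TopologicalSpace X] (h : IsEpsilonSpace X)
    (n : ℕ) : LindelofSpace (Fin n → X) := by
  classical
  refine ⟨isLindelof_of_countable_subcover fun {ι} G hG hcov => ?_⟩
  obtain ⟨𝒱, h𝒱, h𝒱c, h𝒱cov⟩ := h
    {O | IsOpen O ∧ ∃ t : Finset ι, {x : Fin n → X | ∀ i, x i ∈ O} ⊆ ⋃ j ∈ t, G j}
    (fun O hO => hO.1) fun K _ => by
      have hbox : ∀ p : Fin n → X, ∃ (j : ι) (u : Fin n → Set X),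
          (∀ i, IsOpen (u i) ∧ p i ∈ u i) ∧ univ.pi u ⊆ G j := fun p => by
        obtain ⟨j, hj⟩ := mem_iUnion.1 (hcov (mem_univ p))
        obtain ⟨u, hu⟩ := isOpen_pi_iff'.1 (hG j) p hj
        exact ⟨j, u, hu⟩
      choose j u hu huG using hbox
      let P := Fintype.piFinset fun _ : Fin n => K
      -- Around each x ∈ K intersect all box sides belonging to a coordinate equal to x. A tuple in
      -- the power of the union then lies in the box of the tuple k of nearby points of K.
      refine ⟨⋃ x ∈ K, ⋂ p ∈ P, ⋂ i ∈ Finset.univ.filter fun i => p i = x, u p i,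
        ⟨isOpen_biUnion fun x _ => isOpen_biInter_finset fun p _ =>
          isOpen_biInter_finset fun i _ => (hu p i).1, P.image j, fun x hx => ?_⟩, fun x hx => ?_⟩
      · have hx : ∀ i, ∃ k ∈ K, ∀ p ∈ P, ∀ i', p i' = k → x i ∈ u p i' := by simpa using hx
        choose k hkK hk using hx
        have hkP : k ∈ P := Fintype.mem_piFinset.2 hkK
        exact mem_biUnion (Finset.mem_coe.2 (Finset.mem_image_of_mem j hkP))
          (huG k fun i _ => hk i k hkP i rfl)
      · refine mem_biUnion hx (mem_iInter₂.2 fun p _ => mem_iInter₂.2 fun i hi => ?_)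
        rw [← (Finset.mem_filter.1 hi).2]
        exact (hu p i).2
  choose t ht using fun O : 𝒱 => (h𝒱 O.2).2
  have : Countable 𝒱 := h𝒱c.to_subtype
  refine ⟨⋃ O, (t O : Set ι), countable_iUnion fun O => (t O).countable_toSet, fun x _ => ?_⟩
  -- The ω-cover property is applied to the finite set of coordinates of x.
  obtain ⟨O, hO, hxO⟩ := h𝒱cov (Finset.univ.image x) (subset_univ _)
  obtain ⟨j, hj, hxj⟩ := mem_iUnion₂.1 (ht ⟨O, hO⟩
    (show x ∈ {x : Fin n → X | ∀ i, x i ∈ O} from fun i => hxO (by simp)))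
  exact mem_biUnion (mem_iUnion.2 ⟨⟨O, hO⟩, hj⟩) hxj

theorem mainTheorem3 (κ : Cardinal.{0})
    (C : Omega1 → Set Omega1) (hC : IsCountableSetEnumeration C)
    (B : Omega1 → Set (Finset Omega1)) (hB : IsDiamondSequence B)
    (U : Omega1 → Omega1 → Set Omega1) (φ : Omega1 → Omega1 → Finset ℝ)
    (hX : IsConstruction κ C B U φ) :
    (∀ Y : Set (SpaceX U φ), IsEpsilonSpace Y) ∧
      ∀ n : ℕ, LindelofSpace (Fin n → SpaceX U φ) := by
  refine ⟨fun Y => isEpsilonSpace_subtype Y (hX.exists_countable_omegaCover hB Y), fun n => ?_⟩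
  exact IsEpsilonSpace.lindelofSpace_pi (hX.exists_countable_omegaCover hB univ) n
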